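/- Let $k\ge 1$, $\lambda>0$, and let $\nu$ be a probability measure on the ranked simplex $\{s_1\ge\dots\ge s_k\ge 0,\ \sum_i s_i=1\}$. Let $\mathcal P^{(k)}$ be the set of partitions of $\mathbb N=\{1,2,\dots\}$ with at most $k$ blocks, with the metric $d(\pi,\pi')=1/\max\{n:\pi_{|[n]}=\pi'_{|[n]}\}$ for $\pi\neq\pi'$ (and $d(\pi,\pi)=0$), where $\pi_{|A}$ is the restriction of $\pi$ to $A\subseteq\mathbb N$ and $[n]=\{1,\dots,n\}$. Let $\varrho_\nu=\int\varrho_s\,\nu(ds)$, where $\varrho_s$ is the law of the partition of $\mathbb N$ given by $i\sim j\Leftrightarrow X_i=X_j$ for independent $X_1,X_2,\dots$ with $\mathbb P(X_i=j)=s_j$, $1\le j\le k$. For partitions $B,B'$ of $[n]$ with at most $k$ blocks put $$p_n(B,B')=\frac{k!}{(k-\#B')!}\prod_{b\in B}\frac{(k-\#B'_{|b})!}{k!}\,\varrho_\nu(B'_{|b}),$$ where $\#$ is the number of blocks and $\varrho_\nu(B'_{|b})$ is the probability that the restriction to $b$ of a $\varrho_\nu$-distributed partition is $B'_{|b}$;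 put $Q_n(B,B')=\lambda p_n(B,B')$ for $B\ne B'$ and $Q_n(B,B)=\lambda(p_n(B,B)-1)$. A $\varrho_\nu$-Markov process is a process $(B(t))_{t\ge0}$ on $\mathcal P^{(k)}$ such that, for each $n\ge1$, $(B(t)_{|[n]})_{t\ge0}$ is a (time-homogeneous) Markov process with $Q$-matrix $Q_n$. For $\varphi:\mathcal P^{(k)}\to\mathbb R$ continuous, let $P_t\varphi(\pi)=\mathbb E_\pi\varphi(B(t))$, where under $\mathbb E_\pi$ the process $B$ is a $\varrho_\nu$-Markov process with $B(0)=\pi$. Then the $\varrho_\nu$-Markov process has the Feller property, i.e. for every continuous $\varphi:\mathcal P^{(k)}\to\mathbb R$: - $\lim_{t\downarrow0}P_t\varphi(\pi)=\varphi(\pi)$ for every $\pi\in\mathcal P^{(k)}$; - for every $t>0$ the map $\pi\mapsto P_t\varphi(\pi)$ is continuous on $\mathcal P^{(k)}$. -/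

import Mathlib

open Set Filter Topology MeasureTheory
open scoped NNReal

noncomputable section

namespace PaintboxProcess

/-! ### Partitions with at most `k` blocks

The set `{1, 2, …}` is represented by `ℕ` (shifted by one), and `[n] = {1, …, n}` by `Fin n`.
A partition of `α` is an equivalence relation on `α`; its blocks are the equivalence classes. -/

/-- Partitions of `α` with at most `k` blocks. -/
def BlockPartition (k : ℕ) (α : Type*) : Type _ :=
  {r : Setoid α // r.classes.encard ≤ k}

/-- Pulling an equivalence relation back does not increase the number of classes. -/
theorem encard_classes_comap_le {α β : Type*} (f : α → β) (r : Setoid β) :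
    (r.comap f).classes.encard ≤ r.classes.encard := by
  have h : r.classes.encard = ENat.card (Quotient r) :=
    (ENat.card_congr r.quotientEquivClasses).symm
  have h' : (r.comap f).classes.encard = ENat.card (Quotient (r.comap f)) :=
    (ENat.card_congr (r.comap f).quotientEquivClasses).symm
  rw [h', h]
  refine ENat.card_le_card_of_injective
    (f := Quotient.map' (s₁ := r.comap f) (s₂ := r) f (fun _ _ hab => hab)) ?_
  intro a b
  induction a using Quotient.inductionOn
  induction b using Quotient.inductionOn
  intro hab
  exact Quotient.sound (s := r.comap f) (Quotient.exact (s := r) hab)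

namespace BlockPartition

variable {k : ℕ}

/-- The restriction `π_{|[n]}` of a partition `π` of the natural numbers to `[n]`. -/
def restrict (n : ℕ) (π : BlockPartition k ℕ) : BlockPartition k (Fin n) :=
  ⟨π.1.comap (fun i : Fin n => (i : ℕ)), (encard_classes_comap_le _ _).trans π.2⟩

theorem restrict_eq_iff {n : ℕ} {π π' : BlockPartition k ℕ} :
    restrict n π = restrict n π' ↔ ∀ i j : ℕ, i < n → j < n → (π.1 i j ↔ π'.1 i j) := by
  constructor
  · intro h i j hi hj
    have h1 := congrArg Subtype.val h
    exact (Setoid.ext_iff.1 h1) (a := ⟨i, hi⟩) (b := ⟨j, hj⟩)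
  · intro h
    exact Subtype.ext (Setoid.ext fun a b => h a b a.2 b.2)

instance (n : ℕ) : Finite (BlockPartition k (Fin n)) :=
  Finite.of_injective (fun π (i j : Fin n) => π.1 i j) fun π π' h =>
    Subtype.ext (Setoid.ext fun a b => by
      have := congrFun (congrFun h a) b
      simpa using this)

instance (n : ℕ) : Fintype (BlockPartition k (Fin n)) := Fintype.ofFinite _

instance (n : ℕ) : DecidableEq (BlockPartition k (Fin n)) := Classical.decEq _

/-! ### The metric on partitions of the natural numbers -/

/-- `d(π, π') = 1 / max {n : π_{|[n]} = π'_{|[n]}}`, and `0` if `π = π'`. -/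
def partDist (π π' : BlockPartition k ℕ) : ℝ :=
  open Classical in
  if π = π' then 0 else 1 / ((sSup {n : ℕ | restrict n π = restrict n π'} : ℕ) : ℝ)

theorem partDist_nonneg (π π' : BlockPartition k ℕ) : 0 ≤ partDist π π' := by
  unfold partDist
  split_ifs <;> positivity

theorem partDist_comm (π π' : BlockPartition k ℕ) : partDist π π' = partDist π' π := by
  unfold partDist
  have h2 : {n : ℕ | restrict n π = restrict n π'} = {n : ℕ | restrict n π' = restrict n π} :=
    Set.ext fun n => eq_comm
  rw [h2]
  by_cases h : π = π'
  · rw [if_pos h, if_pos h.symm]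
  · rw [if_neg h, if_neg (Ne.symm h)]

theorem restrict_one (π π' : BlockPartition k ℕ) : restrict 1 π = restrict 1 π' := by
  rw [restrict_eq_iff]
  intro i j hi hj
  obtain rfl : i = 0 := by omega
  obtain rfl : j = 0 := by omega
  exact iff_of_true (π.1.refl 0) (π'.1.refl 0)

theorem bddAbove_restrict {π π' : BlockPartition k ℕ} (h : π ≠ π') :
    BddAbove {n : ℕ | restrict n π = restrict n π'} := by
  by_contra hb
  refine h (Subtype.ext (Setoid.ext fun i j => ?_))
  rw [not_bddAbove_iff] at hb
  obtain ⟨n, hn, hlt⟩ := hb (max i j)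
  exact restrict_eq_iff.1 hn i j (by omega) (by omega)

theorem restrict_mono {m n : ℕ} (hmn : m ≤ n) {π π' : BlockPartition k ℕ}
    (h : restrict n π = restrict n π') : restrict m π = restrict m π' := by
  rw [restrict_eq_iff] at h ⊢
  exact fun i j hi hj => h i j (by omega) (by omega)

theorem partDist_le_iff {n : ℕ} (hn : 1 ≤ n) {π π' : BlockPartition k ℕ} :
    partDist π π' ≤ 1 / (n : ℝ) ↔ restrict n π = restrict n π' := by
  unfold partDist
  split_ifs with h
  · subst h
    simp
  · have hmem := Nat.sSup_mem (s := {n : ℕ | restrict n π = restrict n π'})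
      ⟨1, restrict_one π π'⟩ (bddAbove_restrict h)
    have hle (m : ℕ) (hm : restrict m π = restrict m π') :
        m ≤ sSup {n : ℕ | restrict n π = restrict n π'} := le_csSup (bddAbove_restrict h) hm
    set M := sSup {n : ℕ | restrict n π = restrict n π'}
    have hM : 1 ≤ M := hle 1 (restrict_one π π')
    rw [one_div_le_one_div (by exact_mod_cast hM) (by exact_mod_cast hn), Nat.cast_le]
    exact ⟨fun hnM => restrict_mono hnM hmem, hle n⟩

theorem partDist_eq_zero_or (π π' : BlockPartition k ℕ) :
    partDist π π' = 0 ∨ ∃ n : ℕ, 1 ≤ n ∧ partDist π π' = 1 / (n : ℝ) := by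
  by_cases h : π = π'
  · exact Or.inl (by simp [partDist, h])
  · refine Or.inr ⟨_, le_csSup (bddAbove_restrict h) (restrict_one π π'), ?_⟩
    simp [partDist, h]

theorem partDist_triangle (π₁ π₂ π₃ : BlockPartition k ℕ) :
    partDist π₁ π₃ ≤ partDist π₁ π₂ + partDist π₂ π₃ := by
  have h12 := partDist_nonneg π₁ π₂
  have h23 := partDist_nonneg π₂ π₃
  suffices partDist π₁ π₃ ≤ max (partDist π₁ π₂) (partDist π₂ π₃) from
    this.trans (max_le (by linarith) (by linarith))
  have key (n : ℕ) (hn : 1 ≤ n) (ha : partDist π₁ π₂ ≤ 1 / (n : ℝ))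
      (hb : partDist π₂ π₃ ≤ 1 / (n : ℝ)) : partDist π₁ π₃ ≤ 1 / (n : ℝ) :=
    (partDist_le_iff hn).2 (((partDist_le_iff hn).1 ha).trans ((partDist_le_iff hn).1 hb))
  rcases le_total (partDist π₁ π₂) (partDist π₂ π₃) with hle | hle
  · rw [max_eq_right hle]
    rcases partDist_eq_zero_or π₂ π₃ with h0 | ⟨n, hn, h⟩
    · have e : π₂ = π₃ := by
        by_contra hne
        have h1 := le_csSup (bddAbove_restrict hne) (restrict_one π₂ π₃)
        simp only [partDist, hne, if_false, one_div, inv_eq_zero, Nat.cast_eq_zero] at h0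
        omega
      subst e
      exact hle
    · rw [h]
      exact key n hn (by rw [← h]; exact hle) h.le
  · rw [max_eq_left hle]
    rcases partDist_eq_zero_or π₁ π₂ with h0 | ⟨n, hn, h⟩
    · have e : π₁ = π₂ := by
        by_contra hne
        have h1 := le_csSup (bddAbove_restrict hne) (restrict_one π₁ π₂)
        simp only [partDist, hne, if_false, one_div, inv_eq_zero, Nat.cast_eq_zero] at h0
        omega
      subst e
      exact hle
    · rw [h]
      exact key n hn h.le (by rw [← h]; exact hle)

theorem eq_of_partDist_eq_zero {π π' : BlockPartition k ℕ} (h : partDist π π' = 0) :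
    π = π' := by
  by_contra hne
  have h1 := le_csSup (bddAbove_restrict hne) (restrict_one π π')
  simp only [partDist, hne, if_false, one_div, inv_eq_zero, Nat.cast_eq_zero] at h
  omega

/-- The space of partitions of the natural numbers with at most `k` blocks, with the metric `d`. -/
instance : MetricSpace (BlockPartition k ℕ) where
  dist := partDist
  dist_self π := by simp [partDist]
  dist_comm := partDist_comm
  dist_triangle := partDist_triangle
  eq_of_dist_eq_zero := eq_of_partDist_eq_zero

/-- The Borel σ-algebra of the metric `d`. -/
instance : MeasurableSpace (BlockPartition k ℕ) := borel _

instance : BorelSpace (BlockPartition k ℕ) := ⟨rfl⟩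

end BlockPartition

/-! ### The paintbox -/

/-- The ranked `k`-simplex: `s₁ ≥ s₂ ≥ … ≥ s_k ≥ 0` with `s₁ + … + s_k = 1`. -/
def rankedSimplex (k : ℕ) : Set (Fin k → ℝ) :=
  {s | Antitone s ∧ (∀ j, 0 ≤ s j) ∧ ∑ j, s j = 1}

variable {k : ℕ}

/-- The law on `[k]` that gives mass `s j` to the colour `j`. -/
def colourLaw (s : rankedSimplex k) : Measure (Fin k) :=
  ∑ j, ENNReal.ofReal (s.1 j) • Measure.dirac j

instance (s : rankedSimplex k) : IsProbabilityMeasure (colourLaw s) := by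
  constructor
  simp only [colourLaw, Measure.coe_finsetSum, Finset.sum_apply, Measure.smul_apply,
    measure_univ, smul_eq_mul, mul_one]
  rw [← ENNReal.ofReal_sum_of_nonneg (fun j _ => s.2.2.1 j), s.2.2.2, ENNReal.ofReal_one]

/-- The partition `Π(X)` generated by a colouring `X` of the natural numbers with `k` colours:
`i ∼ j` if and only if `X i = X j`. -/
def colouringPartition (X : ℕ → Fin k) : BlockPartition k ℕ :=
  ⟨Setoid.ker X, by
    refine (Set.encard_le_encard (Setoid.classes_ker_subset_fiber_set X)).trans ?_
    refine (Set.encard_le_encard (t := (fun y => {x | X x = y}) '' Set.univ) ?_).trans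
      ((Set.encard_image_le _ _).trans (by simp))
    rintro _ ⟨y, rfl⟩
    exact ⟨y, Set.mem_univ y, rfl⟩⟩

theorem continuous_colouringPartition : Continuous (colouringPartition (k := k)) := by
  rw [continuous_iff_continuousAt]
  intro X
  rw [ContinuousAt, Metric.tendsto_nhds]
  intro ε hε
  obtain ⟨n, hn⟩ := exists_nat_one_div_lt hε
  have hev : ∀ᶠ Y in 𝓝 X, ∀ i ∈ Finset.range (n + 1), Y i = X i := by
    rw [Filter.eventually_all_finset]
    intro i _
    exact (continuous_apply i).continuousAt.eventually
      ((isOpen_discrete {X i}).mem_nhds rfl)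
  filter_upwards [hev] with Y hY
  refine lt_of_le_of_lt ?_ hn
  have h := (BlockPartition.partDist_le_iff (n := n + 1) (by omega)
    (π := colouringPartition Y) (π' := colouringPartition X)).2 ?_
  · push_cast at h
    exact h
  · rw [BlockPartition.restrict_eq_iff]
    intro i j hi hj
    change Y i = Y j ↔ X i = X j
    rw [hY i (by simpa using hi), hY j (by simpa using hj)]

/-- The paintbox `ϱ_s`: the law of `Π(X)` for `X₁, X₂, …` independent with
`ℙ(X_i = j) = s_j`. -/
def paintbox (s : rankedSimplex k) : Measure (BlockPartition k ℕ) :=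
  (Measure.infinitePi fun _ : ℕ => colourLaw s).map colouringPartition

theorem measurable_paintbox : Measurable (paintbox (k := k)) := by
  have hc : Measurable (colouringPartition (k := k)) :=
    continuous_colouringPartition.measurable
  refine (Measure.measurable_map _ hc).comp ?_
  refine Measurable.measure_of_isPiSystem_of_isProbabilityMeasure
    (generateFrom_squareCylinders (α := fun _ : ℕ => Fin k)).symm
    (isPiSystem_squareCylinders (fun _ => MeasurableSpace.isPiSystem_measurableSet) (by simp)) ?_
  rintro _ ⟨I, A, hA, rfl⟩
  simp only [Set.mem_pi, Set.mem_univ, forall_const, Set.mem_ofPred_eq] at hA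
  simp only [Measure.infinitePi_pi (fun _ : ℕ => colourLaw _) (fun i _ => hA i)]
  refine Finset.measurable_prod _ fun i _ => ?_
  simp only [colourLaw, Measure.coe_finsetSum, Finset.sum_apply, Measure.smul_apply, smul_eq_mul]
  refine Finset.measurable_sum _ fun j _ => ?_
  exact (((measurable_pi_apply j).comp measurable_subtype_coe).ennreal_ofReal).mul_const _

/-- The paintbox `ϱ_ν = ∫ ϱ_s ν(ds)`. -/
def paintboxMix (ν : Measure (rankedSimplex k)) : Measure (BlockPartition k ℕ) :=
  ν.bind paintbox

/-! ### Transition probabilities and `Q`-matrices -/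

/-- The number of blocks of a partition (of a finite set). -/
def numBlocks {α : Type*} (r : Setoid α) : ℕ := r.classes.ncard

/-- `ϱ_ν(r)` for a partition `r` of a subset `b` of `[n]`: the probability that the restriction
to `b` of a `ϱ_ν`-distributed partition is `r`. -/
def paintboxProb (ν : Measure (rankedSimplex k)) {n : ℕ} (b : Set (Fin n)) (r : Setoid b) : ℝ :=
  (paintboxMix ν).real {C | C.1.comap (fun i : b => ((i : Fin n) : ℕ)) = r}

/-- The restriction `r_{|b}` of a partition `r` to a subset `b`. -/
def restrictTo {α : Type*} (r : Setoid α) (b : Set α) : Setoid b :=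
  r.comap Subtype.val

/-- The transition probabilities
`p_n(B, B'; ν) = k! / (k - #B')! ∏_{b ∈ B} ((k - #B'_{|b})! / k!) ϱ_ν(B'_{|b})`.
As `#B'_{|b} ≤ #B' ≤ k`, the subtractions are not truncated. -/
def transProb (ν : Measure (rankedSimplex k)) (n : ℕ) (B B' : BlockPartition k (Fin n)) : ℝ :=
  (k.factorial : ℝ) / ((k - numBlocks B'.1).factorial : ℝ) *
    ∏ᶠ b ∈ B.1.classes,
      ((k - numBlocks (restrictTo B'.1 b)).factorial : ℝ) / (k.factorial : ℝ) *
        paintboxProb ν b (restrictTo B'.1 b)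

/-- The matrix `Q_n^ν`. -/
def genMatrix (lam : ℝ) (ν : Measure (rankedSimplex k)) (n : ℕ) :
    Matrix (BlockPartition k (Fin n)) (BlockPartition k (Fin n)) ℝ :=
  Matrix.of fun B B' =>
    lam * if B = B' then transProb ν n B B - 1 else transProb ν n B B'

/-! ### Markov processes -/

/-- `p` is a stochastic transition semigroup on the finite set `S` whose `Q`-matrix, i.e. the
matrix of right derivatives at time `0`, is `Q`. -/
structure IsTransitionSemigroup {S : Type*} [Fintype S] [DecidableEq S]
    (Q : Matrix S S ℝ) (p : ℝ≥0 → Matrix S S ℝ) : Prop where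
  nonneg : ∀ t a b, 0 ≤ p t a b
  sum_eq_one : ∀ t a, ∑ b, p t a b = 1
  zero : p 0 = 1
  add : ∀ s t, p (s + t) = p s * p t
  rates : ∀ a b, Tendsto (fun h : ℝ≥0 => (p h a b - (1 : Matrix S S ℝ) a b) / (h : ℝ))
    (𝓝[>] 0) (𝓝 (Q a b))

/-- Under `P`, the process `X` on the finite set `S` is a time-homogeneous Markov process with
`Q`-matrix `Q`: for some transition semigroup `p` with `Q`-matrix `Q`, and for all times `s, u`
and all finitely many times `r ∈ F` before `s`, the conditional probability of `X (s + u) = c`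
given the values `X s = x s` and `X r = x r`, `r ∈ F`, is `p u (x s) c`. -/
def IsMarkovWithQMatrix {Ω : Type*} [MeasurableSpace Ω] (P : Measure Ω)
    {S : Type*} [Fintype S] [DecidableEq S] (Q : Matrix S S ℝ) (X : ℝ≥0 → Ω → S) : Prop :=
  ∃ p : ℝ≥0 → Matrix S S ℝ, IsTransitionSemigroup Q p ∧
    ∀ (s u : ℝ≥0) (F : Finset ℝ≥0), (∀ r ∈ F, r ≤ s) → ∀ (x : ℝ≥0 → S) (c : S),
      P.real {ω | (∀ r ∈ F, X r ω = x r) ∧ X s ω = x s ∧ X (s + u) ω = c} =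
        P.real {ω | (∀ r ∈ F, X r ω = x r) ∧ X s ω = x s} * p u (x s) c

/-- Under `P`, the process `B` is a `ϱ_ν`-Markov process (with rate `lam`): for each `n ≥ 1`, its
restriction to `[n]` is a Markov process with `Q`-matrix `Q_n^ν`. -/
structure IsPaintboxMarkov (lam : ℝ) (ν : Measure (rankedSimplex k))
    {Ω : Type*} [MeasurableSpace Ω] (P : Measure Ω)
    (B : ℝ≥0 → Ω → BlockPartition k ℕ) : Prop where
  measurable : ∀ t, Measurable (B t)
  markov : ∀ n : ℕ, 1 ≤ n → IsMarkovWithQMatrix P (genMatrix lam ν n)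
    (fun t ω => (B t ω).restrict n)

/-- `ℙ_t φ(π) = 𝔼_π φ(B(t))`, where the process `B π`, defined on a space with the probability
measure `P π`, starts from `π`. -/
def semigroup {Ω : BlockPartition k ℕ → Type*} [∀ π, MeasurableSpace (Ω π)]
    (P : ∀ π, Measure (Ω π)) (B : ∀ π, ℝ≥0 → Ω π → BlockPartition k ℕ)
    (t : ℝ≥0) (φ : BlockPartition k ℕ → ℝ) (π : BlockPartition k ℕ) : ℝ :=
  ∫ ω, φ (B π t ω) ∂(P π)

end PaintboxProcess

end

/-! The space of partitions is compact, so a continuous `φ` is uniformly within `ε` of a function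
`g` of the restriction to some `[n]` (`exists_approx_restrict`). Hence `P_t φ(π)` is within `ε` of
the finite sum `∑ c, p t (π_{|[n]}) c * g c`, where `p` is the semigroup of the finite chain on
`[n]` (`abs_integral_sub_le`). This sum tends to `g(π_{|[n]})` as `t ↓ 0`, and it is locally
constant in `π`, because nearby partitions have the same restriction to `[n]`.

The processes started at different `π` are unrelated, and each comes with its own semigroup. The
second claim therefore needs the `Q`-matrix to determine the semigroup
(`IsTransitionSemigroup.unique`). -/

/-- Telescoping. All powers of `b` are bounded by hypothesis, including `b ^ 0`, since `‖1‖ ≤ 1` can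
fail in a normed ring. -/
theorem norm_pow_sub_pow_le {R : Type*} [NormedRing R] {a b : R} (ha : ‖a‖ ≤ 1)
    (hb : ∀ n : ℕ, ‖b ^ n‖ ≤ 1) (n : ℕ) : ‖a ^ n - b ^ n‖ ≤ n * ‖a - b‖ := by
  induction n with
  | zero => simp
  | succ n ih =>
    have h : a ^ (n + 1) - b ^ (n + 1) = a * (a ^ n - b ^ n) + (a - b) * b ^ n := by
      rw [pow_succ', pow_succ']; noncomm_ring
    calc ‖a ^ (n + 1) - b ^ (n + 1)‖
        ≤ ‖a‖ * ‖a ^ n - b ^ n‖ + ‖a - b‖ * ‖b ^ n‖ := by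
          rw [h]
          exact (norm_add_le _ _).trans (add_le_add (norm_mul_le _ _) (norm_mul_le _ _))
      _ ≤ 1 * (n * ‖a - b‖) + ‖a - b‖ * 1 := by
          gcongr
          exact hb n
      _ = ((n + 1 : ℕ) : ℝ) * ‖a - b‖ := by push_cast; ring

namespace PaintboxProcess

/-! ### Transition semigroups on a finite set -/

namespace IsTransitionSemigroup

variable {S : Type*} [Fintype S] [DecidableEq S] {Q : Matrix S S ℝ} {p q : ℝ≥0 → Matrix S S ℝ}

theorem pow_eq (hp : IsTransitionSemigroup Q p) (h : ℝ≥0) (n : ℕ) : p h ^ n = p (n * h) := by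
  induction n with
  | zero => simp [hp.zero]
  | succ n ih => rw [pow_succ, ih, ← hp.add]; push_cast; ring_nf

-- The operator norm for the sup norm is the largest absolute row sum, so stochastic matrices have
-- norm at most `1`.
attribute [local instance] Matrix.linftyOpNormedRing Matrix.linftyOpNormedAlgebra

theorem norm_le_one (hp : IsTransitionSemigroup Q p) (t : ℝ≥0) : ‖p t‖ ≤ 1 := by
  rw [Matrix.linfty_opNorm_def]
  refine (NNReal.coe_le_coe (r₂ := 1)).2 (Finset.sup_le fun a _ => ?_)
  rw [← NNReal.coe_le_coe]
  push_cast
  simp only [Real.norm_eq_abs, abs_of_nonneg (hp.nonneg t a _), hp.sum_eq_one t a, le_refl]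

/-- A transition semigroup on a finite set is determined by its `Q`-matrix. -/
theorem unique (hp : IsTransitionSemigroup Q p) (hq : IsTransitionSemigroup Q q) : p = q := by
  funext t
  rcases eq_or_ne t 0 with rfl | ht
  · rw [hp.zero, hq.zero]
  have hlim : Tendsto (fun h : ℝ≥0 => ‖(h : ℝ)⁻¹ • (p h - q h)‖) (𝓝[>] 0) (𝓝 0) := by
    rw [← norm_zero (E := Matrix S S ℝ)]
    refine Tendsto.norm (tendsto_pi_nhds.2 fun a => tendsto_pi_nhds.2 fun b => ?_)
    have h := (hp.rates a b).sub (hq.rates a b)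
    rw [sub_self] at h
    refine h.congr fun x => ?_
    simp only [Matrix.smul_apply, Matrix.sub_apply, smul_eq_mul]
    ring
  have hseq : Tendsto (fun n : ℕ => t / ((n : ℝ≥0) + 1)) atTop (𝓝[>] 0) := by
    refine tendsto_nhdsWithin_iff.2 ⟨?_, Eventually.of_forall fun n => ?_⟩
    · have h := (tendsto_one_div_add_atTop_nhds_zero_nat (𝕜 := ℝ≥0)).const_mul t
      simpa [div_eq_mul_inv] using h
    · exact div_pos (pos_iff_ne_zero.2 ht) (by positivity)
  have hle (n : ℕ) : ‖p t - q t‖ ≤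
      t * ‖((t / ((n : ℝ≥0) + 1) : ℝ≥0) : ℝ)⁻¹ •
        (p (t / ((n : ℝ≥0) + 1)) - q (t / ((n : ℝ≥0) + 1)))‖ := by
    set h := t / ((n : ℝ≥0) + 1) with hh
    have e : ((n + 1 : ℕ) : ℝ≥0) * h = t := by
      rw [hh]; push_cast; field_simp
    have e' : (t : ℝ) = ((n + 1 : ℕ) : ℝ) * (h : ℝ) := by rw [← e]; push_cast; rfl
    have hpos : (0 : ℝ) < h := by
      rw [hh]; exact_mod_cast div_pos (pos_iff_ne_zero.2 ht) (by positivity)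
    have key := norm_pow_sub_pow_le (hp.norm_le_one h)
      (fun m => by rw [hq.pow_eq]; exact hq.norm_le_one _) (b := q h) (n + 1)
    rw [hp.pow_eq, hq.pow_eq, e] at key
    refine key.trans (le_of_eq ?_)
    rw [norm_smul, norm_inv, Real.norm_of_nonneg hpos.le, e']
    field_simp
  have h0 : ‖p t - q t‖ ≤ 0 := by
    have h := (hlim.comp hseq).const_mul (t : ℝ)
    rw [mul_zero] at h
    exact ge_of_tendsto' h hle
  exact sub_eq_zero.1 (norm_le_zero_iff.1 h0)

theorem tendsto_zero (hp : IsTransitionSemigroup Q p) (a b : S) :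
    Tendsto (fun t => p t a b) (𝓝[>] 0) (𝓝 ((1 : Matrix S S ℝ) a b)) := by
  have hid : Tendsto (fun h : ℝ≥0 => (h : ℝ)) (𝓝[>] 0) (𝓝 0) :=
    (NNReal.continuous_coe.tendsto' 0 0 rfl).mono_left nhdsWithin_le_nhds
  have h := ((hp.rates a b).mul hid).add_const ((1 : Matrix S S ℝ) a b)
  rw [mul_zero, zero_add] at h
  refine h.congr' ?_
  filter_upwards [self_mem_nhdsWithin] with t ht
  have : (t : ℝ) ≠ 0 := by exact_mod_cast (ne_of_gt ht)
  field_simp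
  ring

theorem tendsto_sum_mul (hp : IsTransitionSemigroup Q p) (a : S) (g : S → ℝ) :
    Tendsto (fun t => ∑ c, p t a c * g c) (𝓝[>] 0) (𝓝 (g a)) := by
  have h := tendsto_finsetSum Finset.univ fun c _ => (hp.tendsto_zero a c).mul_const (g c)
  simpa [Matrix.one_apply] using h

end IsTransitionSemigroup

/-! ### Compactness and approximation by finite restrictions -/

namespace BlockPartition

variable {k : ℕ}

theorem dist_le_iff {n : ℕ} (hn : 1 ≤ n) {π π' : BlockPartition k ℕ} :
    dist π π' ≤ 1 / (n : ℝ) ↔ restrict n π = restrict n π' :=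
  partDist_le_iff hn

theorem eventually_restrict_eq {n : ℕ} (hn : 1 ≤ n) (π : BlockPartition k ℕ) :
    ∀ᶠ π' in 𝓝 π, restrict n π' = restrict n π := by
  filter_upwards [Metric.ball_mem_nhds π (show (0 : ℝ) < 1 / n by positivity)] with π' h
  exact (dist_le_iff hn).1 (Metric.mem_ball.1 h).le

theorem isOpen_restrict_eq {n : ℕ} (hn : 1 ≤ n) (c : BlockPartition k (Fin n)) :
    IsOpen {π : BlockPartition k ℕ | restrict n π = c} := by
  rw [isOpen_iff_mem_nhds]
  rintro π rfl
  exact eventually_restrict_eq hn π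

/-- Colour each block with its own colour. Compactness follows: the space is a continuous image of
the compact product `ℕ → Fin k`. -/
theorem surjective_colouringPartition : Function.Surjective (colouringPartition (k := k)) := by
  intro π
  have hcard : ENat.card (Quotient π.1) ≤ k := by
    rw [ENat.card_congr π.1.quotientEquivClasses]
    exact π.2
  have : Finite (Quotient π.1) :=
    ENat.card_lt_top.1 (hcard.trans_lt (ENat.natCast_lt_top k))
  have := Fintype.ofFinite (Quotient π.1)
  rw [ENat.card_eq_coe_fintype_card, Nat.cast_le] at hcard
  obtain ⟨f⟩ := Function.Embedding.nonempty_of_card_le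
    (α := Quotient π.1) (β := Fin k) (by simpa using hcard)
  refine ⟨fun i => f (Quotient.mk π.1 i), Subtype.ext (Setoid.ext fun i j => ?_)⟩
  change f _ = f _ ↔ _
  rw [f.injective.eq_iff]
  exact Quotient.eq

instance : CompactSpace (BlockPartition k ℕ) :=
  ⟨surjective_colouringPartition.range_eq ▸ isCompact_range continuous_colouringPartition⟩

/-- A continuous function is uniformly approximated by functions of finite restrictions. -/
theorem exists_approx_restrict {φ : BlockPartition k ℕ → ℝ} (hφ : Continuous φ) {ε : ℝ}
    (hε : 0 < ε) : ∃ n : ℕ, 1 ≤ n ∧ ∃ g : BlockPartition k (Fin n) → ℝ,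
      ∀ π, |φ π - g (restrict n π)| ≤ ε := by
  obtain ⟨δ, hδ, h⟩ := Metric.uniformContinuous_iff.1
    (CompactSpace.uniformContinuous_of_continuous hφ) ε hε
  obtain ⟨n, hn⟩ := exists_nat_one_div_lt hδ
  -- `g c` is the value of `φ` at a chosen partition restricting to `c`; the default `0` is never
  -- evaluated at a restriction `restrict (n + 1) π`.
  refine ⟨n + 1, by omega, fun c =>
    open Classical in if hc : ∃ π, restrict (n + 1) π = c then φ hc.choose else 0, fun π => ?_⟩
  have hc : ∃ π', restrict (n + 1) π' = restrict (n + 1) π := ⟨π, rfl⟩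
  simp only [dif_pos hc]
  have hd := (dist_le_iff (by omega)).2 hc.choose_spec.symm
  push_cast at hd
  exact (h (hd.trans_lt hn)).le

end BlockPartition

/-! ### One-dimensional laws of the restricted process -/

open BlockPartition

variable {k : ℕ} {lam : ℝ} {ν : Measure (rankedSimplex k)}

/-- By uniqueness, `p` may be any semigroup with this `Q`-matrix, in particular one obtained from a
process with another starting point. -/
theorem IsMarkovWithQMatrix.real_eq {Ω : Type*} [MeasurableSpace Ω] {P : Measure Ω}
    [IsProbabilityMeasure P] {S : Type*} [Fintype S] [DecidableEq S] {Q : Matrix S S ℝ}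
    {X : ℝ≥0 → Ω → S} (hX : IsMarkovWithQMatrix P Q X) {a : S} (h0 : ∀ᵐ ω ∂P, X 0 ω = a)
    {p : ℝ≥0 → Matrix S S ℝ} (hp : IsTransitionSemigroup Q p) (t : ℝ≥0) (c : S) :
    P.real {ω | X t ω = c} = p t a c := by
  obtain ⟨q, hq, hm⟩ := hX
  obtain rfl := hq.unique hp
  -- At time `0` with no earlier times, the conditioning event has probability `1`.
  have h := hm 0 t ∅ (by simp) (fun _ => a) c
  have e1 : {ω | (∀ r ∈ (∅ : Finset ℝ≥0), X r ω = a) ∧ X 0 ω = a ∧ X (0 + t) ω = c}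
      =ᵐ[P] {ω | X t ω = c} :=
    eventuallyEq_set.2 (by filter_upwards [h0] with ω hω; simp [hω])
  have e2 : {ω | (∀ r ∈ (∅ : Finset ℝ≥0), X r ω = a) ∧ X 0 ω = a} =ᵐ[P] univ :=
    eventuallyEq_set.2 (by filter_upwards [h0] with ω hω; simp [hω])
  rw [measureReal_congr e1, measureReal_congr e2] at h
  simpa using h

namespace IsPaintboxMarkov

variable {Ω : Type*} [MeasurableSpace Ω] {P : Measure Ω} [IsProbabilityMeasure P]
  {B : ℝ≥0 → Ω → BlockPartition k ℕ}

theorem integral_restrict (hB : IsPaintboxMarkov lam ν P B) {π : BlockPartition k ℕ}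
    (h0 : ∀ᵐ ω ∂P, B 0 ω = π) {n : ℕ} (hn : 1 ≤ n)
    {p : ℝ≥0 → Matrix (BlockPartition k (Fin n)) (BlockPartition k (Fin n)) ℝ}
    (hp : IsTransitionSemigroup (genMatrix lam ν n) p) (g : BlockPartition k (Fin n) → ℝ)
    (t : ℝ≥0) :
    Integrable (fun ω => g (restrict n (B t ω))) P ∧
      ∫ ω, g (restrict n (B t ω)) ∂P = ∑ c, p t (restrict n π) c * g c := by
  have hmeas (c : BlockPartition k (Fin n)) : MeasurableSet {ω | restrict n (B t ω) = c} :=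
    hB.measurable t (isOpen_restrict_eq hn c).measurableSet
  have hint (c : BlockPartition k (Fin n)) :
      Integrable ({ω | restrict n (B t ω) = c}.indicator fun _ => g c) P :=
    (integrable_const _).indicator (hmeas c)
  have hsum : (fun ω => g (restrict n (B t ω))) =
      fun ω => ∑ c, {ω | restrict n (B t ω) = c}.indicator (fun _ => g c) ω := by
    funext ω
    simp [Set.indicator_apply]
  rw [hsum]
  refine ⟨integrable_finsetSum _ fun c _ => hint c, ?_⟩
  rw [integral_finsetSum _ fun c _ => hint c]
  refine Finset.sum_congr rfl fun c _ => ?_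
  rw [integral_indicator_const _ (hmeas c), (hB.markov n hn).real_eq
    (h0.mono fun ω hω => congrArg (restrict n) hω) hp, smul_eq_mul]

theorem abs_integral_sub_le (hB : IsPaintboxMarkov lam ν P B) {π : BlockPartition k ℕ}
    (h0 : ∀ᵐ ω ∂P, B 0 ω = π) {n : ℕ} (hn : 1 ≤ n)
    {p : ℝ≥0 → Matrix (BlockPartition k (Fin n)) (BlockPartition k (Fin n)) ℝ}
    (hp : IsTransitionSemigroup (genMatrix lam ν n) p) {g : BlockPartition k (Fin n) → ℝ}
    {φ : BlockPartition k ℕ → ℝ} (hφ : Continuous φ) {ε : ℝ}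
    (hg : ∀ π, |φ π - g (restrict n π)| ≤ ε) (t : ℝ≥0) :
    |∫ ω, φ (B t ω) ∂P - ∑ c, p t (restrict n π) c * g c| ≤ ε := by
  obtain ⟨hi, he⟩ := hB.integral_restrict h0 hn hp g t
  obtain ⟨C, hC⟩ := isCompact_univ.exists_bound_of_continuousOn hφ.continuousOn
  have hφi : Integrable (fun ω => φ (B t ω)) P :=
    Integrable.of_bound (hφ.measurable.comp (hB.measurable t)).aestronglyMeasurable C
      (Eventually.of_forall fun ω => hC _ (mem_univ _))
  rw [← he, ← integral_sub hφi hi, ← Real.norm_eq_abs]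
  simpa using norm_integral_le_of_norm_le_const (μ := P)
    (Eventually.of_forall fun ω => (Real.norm_eq_abs _).trans_le (hg (B t ω)))

end IsPaintboxMarkov

end PaintboxProcess

theorem corollary2 {k : ℕ} (lam : ℝ) (hlam : 0 < lam)
    (ν : Measure (PaintboxProcess.rankedSimplex k)) [IsProbabilityMeasure ν]
    {Ω : PaintboxProcess.BlockPartition k ℕ → Type*} [∀ π, MeasurableSpace (Ω π)]
    (P : ∀ π, Measure (Ω π)) [∀ π, IsProbabilityMeasure (P π)]
    (B : ∀ π, ℝ≥0 → Ω π → PaintboxProcess.BlockPartition k ℕ)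
    (hB : ∀ π, PaintboxProcess.IsPaintboxMarkov lam ν (P π) (B π))
    (hB0 : ∀ π, ∀ᵐ ω ∂(P π), B π 0 ω = π)
    (φ : PaintboxProcess.BlockPartition k ℕ → ℝ) (hφ : Continuous φ) :
    (∀ π, Tendsto (fun t : ℝ≥0 => PaintboxProcess.semigroup P B t φ π) (𝓝[>] 0) (𝓝 (φ π))) ∧
      ∀ t : ℝ≥0, 0 < t → Continuous fun π => PaintboxProcess.semigroup P B t φ π := by
  open PaintboxProcess BlockPartition in
  constructor
  · intro π
    rw [Metric.tendsto_nhds]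
    intro ε hε
    obtain ⟨n, hn, g, hg⟩ := exists_approx_restrict hφ (show 0 < ε / 3 by positivity)
    obtain ⟨p, hp, -⟩ := (hB π).markov n hn
    filter_upwards [Metric.tendsto_nhds.1 (hp.tendsto_sum_mul (restrict n π) g) (ε / 3)
      (by positivity)] with t ht
    have h1 := (hB π).abs_integral_sub_le (hB0 π) hn hp hφ hg t
    have h2 := hg π
    rw [Real.dist_eq] at ht ⊢
    unfold semigroup
    rw [abs_lt] at *
    rw [abs_le] at *
    constructor <;> linarith
  · intro t _
    rw [continuous_iff_continuousAt]
    intro π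
    rw [ContinuousAt, Metric.tendsto_nhds]
    intro ε hε
    obtain ⟨n, hn, g, hg⟩ := exists_approx_restrict hφ (show 0 < ε / 3 by positivity)
    -- This `p`, taken from the process started at `π`, also serves for every `π'`.
    obtain ⟨p, hp, -⟩ := (hB π).markov n hn
    filter_upwards [eventually_restrict_eq hn π] with π' hπ'
    have h1 := (hB π).abs_integral_sub_le (hB0 π) hn hp hφ hg t
    have h2 := (hB π').abs_integral_sub_le (hB0 π') hn hp hφ hg t
    -- Both values of `P_t φ` are now within `ε / 3` of the same number.
    rw [hπ'] at h2
    rw [Real.dist_eq, abs_lt]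
    unfold semigroup
    rw [abs_le] at *
    constructor <;> linarith
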